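/- Let $n\ge 0$ be an integer and $a,b\in\mathbb R$. **Protocols.** A protocol for committing to an $n$-bit string is a two-party quantum protocol on finite-dimensional Hilbert spaces $\mathcal H_A\otimes\mathcal H_B\otimes\mathcal H_C$ (Alice's machine, Bob's machine, the channel). Alice's machine starts in a pure state that encodes her string $x\in\{0,1\}^n$; Bob's machine and the channel start in fixed pure states. There are a commit phase and a reveal phase, each with a fixed finite number of rounds; in a round Alice applies a unitary on $\mathcal H_A\otimes\mathcal H_C$ and then Bob applies a unitary on $\mathcal H_B\otimes\mathcal H_C$. At the very end Bob measures his machine; the outcome is a string (he accepts the opening of that string) or "reject". Let $\rho_x$ be the reduced state of Bob's machine after the commit phase when both parties are honest and Alice holds $x$. **Security.** The protocol is an $(n,a,b)$-QBSC if * (correctness) for every $x$, if both parties are honest and Alice holds $x$, then Bob accepts the opening of $x$ with probability $1$; * (concealing) $\sum_{x}\operatorname{Tr}(M_x\rho_x)\le 2^b$ for every measurement (POVM) $\{M_x\}_{x\in\{0,1\}^n}$ on $\mathcal H_B$; * (binding) if Bob is honest, then for all commitments of Alice $\sum_{x}p^A_x\le 2^a$. Here a commitment consists of a machine for Alice of arbitrary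 finite dimension, an initial pure state of it, and her unitaries in the commit phase; $p^A_x$ is the maximal probability that Bob accepts the opening of $x$, over all choices (which may depend on $x$) of Alice's unitaries in the reveal phase. It is an $(n,a,b)$-QBSC$_\xi$ if the same holds with the concealing condition replaced by $\xi(\mathcal E)\le b$, where $\mathcal E=\{p_x,\rho_x\}$ with $p_x=2^{-n}$ and $$\xi(\mathcal E)=n-H_2(\rho_{AB}|\rho),\qquad H_2(\rho_{AB}|\rho)=-\log_2\operatorname{Tr}\Big[\big((\mathrm{id}\otimes\rho^{-1/2})\rho_{AB}\big)^2\Big],$$ $\rho_{AB}=\sum_x p_x|x\rangle\langle x|\otimes\rho_x$, $\rho=\sum_x p_x\rho_x$, the inverse $\rho^{-1/2}$ being taken on the support of $\rho$. **Theorem.** Let $c=5\log_2 5-4$ $(\approx 7.61$, with $|c-7.61|<0.005)$. Every $(n,a,b)$-QBSC is an $(n,a,b)$-QBSC$_\xi$. If $a+b+c<n$, then no $(n,a,b)$-QBSC$_\xi$ exists, and hence no $(n,a,b)$-QBSC exists. -/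

import Mathlib

open scoped Kronecker ComplexOrder

namespace QBSC

universe u v w

/-- Bit strings of length `n`. -/
abbrev Str (n : ℕ) : Type := Fin n → Bool

section States

variable {A : Type u} {B : Type v} {C : Type w}
  [Fintype A] [DecidableEq A] [Fintype B] [DecidableEq B] [Fintype C] [DecidableEq C]

/-- A vector of a finite-dimensional Hilbert space with a fixed orthonormal basis is a unit
vector (a pure state). -/
def IsPure {X : Type*} [Fintype X] (ψ : X → ℂ) : Prop := ∑ i, ‖ψ i‖ ^ 2 = 1

/-- The product vector `α ⊗ β ⊗ κ` on (Alice's machine) ⊗ (Bob's machine) ⊗ (channel). -/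
def productVec (α : A → ℂ) (β : B → ℂ) (κ : C → ℂ) : A × B × C → ℂ :=
  fun i => α i.1 * β i.2.1 * κ i.2.2

/-- Alice applies a unitary to her machine and the channel. -/
def aliceAct (U : Matrix.unitaryGroup (A × C) ℂ) (ψ : A × B × C → ℂ) : A × B × C → ℂ :=
  fun i => ∑ j : A × C, (U : Matrix (A × C) (A × C) ℂ) (i.1, i.2.2) j * ψ (j.1, i.2.1, j.2)

/-- Bob applies a unitary to his machine and the channel. -/
def bobAct (V : Matrix.unitaryGroup (B × C) ℂ) (ψ : A × B × C → ℂ) : A × B × C → ℂ :=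
  fun i => ∑ j : B × C, (V : Matrix (B × C) (B × C) ℂ) i.2 j * ψ (i.1, j)

/-- The joint vector after the given number of rounds of communication; in round `i` Alice
applies `U i` and hands over the channel, then Bob applies `V i` and hands it back. -/
def evolve (U : ℕ → Matrix.unitaryGroup (A × C) ℂ) (V : ℕ → Matrix.unitaryGroup (B × C) ℂ)
    (ψ : A × B × C → ℂ) : ℕ → (A × B × C → ℂ)
  | 0 => ψ
  | k + 1 => bobAct (V k) (aliceAct (U k) (evolve U V ψ k))

/-- The reduced density matrix of Bob's machine (partial trace over Alice and the channel). -/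
def bobState (ψ : A × B × C → ℂ) : Matrix B B ℂ :=
  fun b b' => ∑ a, ∑ c, ψ (a, b, c) * star (ψ (a, b', c))

/-- A measurement (POVM) with outcomes in `X` on the space with basis `B`. -/
structure Measurement (X : Type*) [Fintype X] (B : Type v) [Fintype B] [DecidableEq B] where
  op : X → Matrix B B ℂ
  posSemidef : ∀ x, (op x).PosSemidef
  sum_eq_one : ∑ x, op x = 1

/-- Born rule: the probability of outcome `x` in the state with density matrix `ρ`. -/
def Measurement.prob {X : Type*} [Fintype X] (M : Measurement X B) (ρ : Matrix B B ℂ) (x : X) :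
    ℝ :=
  (M.op x * ρ).trace.re

end States

section Information

variable {X : Type u} [Fintype X] [DecidableEq X] {B : Type v} [Fintype B] [DecidableEq B]

/-- The average state `ρ = ∑ x, p_x ρ_x` of the ensemble `{p_x, ρ_x}`. -/
noncomputable def averageState (p : X → ℝ) (ρ : X → Matrix B B ℂ) : Matrix B B ℂ :=
  ∑ x, (p x : ℂ) • ρ x

/-- The classical-quantum state `∑ x, p_x |x⟩⟨x| ⊗ ρ_x`. -/
noncomputable def cqState (p : X → ℝ) (ρ : X → Matrix B B ℂ) : Matrix (X × B) (X × B) ℂ :=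
  ∑ x, (p x : ℂ) • (Matrix.single x x (1 : ℂ) ⊗ₖ ρ x)

/-- `ρ ^ (-1/2)`, the inverse being taken on the support of the positive semidefinite `ρ`
(the eigenvalue `0` is sent to `0`). -/
noncomputable def invSqrt (ρ : Matrix B B ℂ) : Matrix B B ℂ :=
  cfc (fun t : ℝ => (Real.sqrt t)⁻¹) ρ

/-- `H₂(ρ_AB | ρ) = - log₂ Tr [((1 ⊗ ρ^(-1/2)) ρ_AB)²]`. -/
noncomputable def collisionEntropy (ρAB : Matrix (X × B) (X × B) ℂ) (ρ : Matrix B B ℂ) : ℝ :=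
  -Real.logb 2 ((((1 : Matrix X X ℂ) ⊗ₖ invSqrt ρ) * ρAB) ^ 2).trace.re

/-- `ξ(𝓔) = n - H₂(ρ_AB | ρ)` for an ensemble `𝓔 = {p_x, ρ_x}` indexed by `n`-bit strings. -/
noncomputable def xi {n : ℕ} (p : Str n → ℝ) (ρ : Str n → Matrix B B ℂ) : ℝ :=
  n - collisionEntropy (cqState p ρ) (averageState p ρ)

end Information

/-- A two-party quantum protocol for committing to an `n`-bit string. The machines of Alice and
Bob and the channel have the finite-dimensional Hilbert spaces with orthonormal bases `A`, `B`,
`C`, and start in pure states, Alice's one encoding her string. Both parties act unitarily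
during `commitRounds` rounds of commit phase and `revealRounds` rounds of reveal phase (later
entries of the sequences of unitaries are not used). At the very end Bob measures his
machine: outcome `some x` means that he accepts the opening of `x`, outcome `none` that he
rejects. -/
structure Protocol (n : ℕ) (A : Type u) (B : Type v) (C : Type w)
    [Fintype A] [DecidableEq A] [Fintype B] [DecidableEq B] [Fintype C] [DecidableEq C] where
  aliceInit : Str n → A → ℂ
  bobInit : B → ℂ
  channelInit : C → ℂ
  aliceInit_pure : ∀ x, IsPure (aliceInit x)
  bobInit_pure : IsPure bobInit
  channelInit_pure : IsPure channelInit
  commitRounds : ℕ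
  revealRounds : ℕ
  aliceCommit : ℕ → Matrix.unitaryGroup (A × C) ℂ
  bobCommit : ℕ → Matrix.unitaryGroup (B × C) ℂ
  aliceReveal : ℕ → Matrix.unitaryGroup (A × C) ℂ
  bobReveal : ℕ → Matrix.unitaryGroup (B × C) ℂ
  test : Measurement (Option (Str n)) B

namespace Protocol

variable {n : ℕ} {A : Type u} {B : Type v} {C : Type w}
  [Fintype A] [DecidableEq A] [Fintype B] [DecidableEq B] [Fintype C] [DecidableEq C]

/-- The joint state after the commit phase with honest Bob, when the committer has a machine
with basis `A'`, prepares `α` and applies the unitaries `U`. -/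
def afterCommit (P : Protocol n A B C) {A' : Type u} [Fintype A'] [DecidableEq A']
    (α : A' → ℂ) (U : ℕ → Matrix.unitaryGroup (A' × C) ℂ) : A' × B × C → ℂ :=
  evolve U P.bobCommit (productVec α P.bobInit P.channelInit) P.commitRounds

/-- The probability that honest Bob accepts the opening of `x`, when the committer prepares `α`,
applies the unitaries `U` in the commit phase and `W` in the reveal phase. -/
def revealProb (P : Protocol n A B C) {A' : Type u} [Fintype A'] [DecidableEq A']
    (α : A' → ℂ) (U W : ℕ → Matrix.unitaryGroup (A' × C) ℂ) (x : Str n) : ℝ :=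
  P.test.prob (bobState (evolve W P.bobReveal (P.afterCommit α U) P.revealRounds)) (some x)

/-- The state `ρ_x` that Bob holds after the commit phase, both parties being honest. -/
def commitState (P : Protocol n A B C) (x : Str n) : Matrix B B ℂ :=
  bobState (P.afterCommit (P.aliceInit x) P.aliceCommit)

/-- If both parties are honest then Bob learns `x` and accepts, with certainty. -/
def IsCorrect (P : Protocol n A B C) : Prop :=
  ∀ x, P.revealProb (P.aliceInit x) P.aliceCommit P.aliceReveal x = 1

/-- `∑ x, p^A_x ≤ 2 ^ a` for all commitments of Alice. A cheating Alice has a machine of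
arbitrary finite dimension. Her commitment is an initial pure state together with her
unitaries in the commit phase. In the reveal phase she plays a strategy `W x` that may depend on
the string `x` that she wants to reveal. -/
def IsBinding (P : Protocol n A B C) (a : ℝ) : Prop :=
  ∀ (A' : Type u) [Fintype A'] [DecidableEq A'] (α : A' → ℂ), IsPure α →
    ∀ (U : ℕ → Matrix.unitaryGroup (A' × C) ℂ) (W : Str n → ℕ → Matrix.unitaryGroup (A' × C) ℂ),
      ∑ x, P.revealProb α U (W x) x ≤ (2 : ℝ) ^ a

/-- `∑ x, p^B_{x|x} ≤ 2 ^ b` for every measurement by which Bob guesses the string from his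
state before the reveal phase. -/
def IsConcealing (P : Protocol n A B C) (b : ℝ) : Prop :=
  ∀ M : Measurement (Str n) B, ∑ x, M.prob (P.commitState x) x ≤ (2 : ℝ) ^ b

/-- `P` is an `(n, a, b)`-QBSC. -/
structure IsQBSC (P : Protocol n A B C) (a b : ℝ) : Prop where
  correct : P.IsCorrect
  concealing : P.IsConcealing b
  binding : P.IsBinding a

/-- `P` is an `(n, a, b)`-QBSC with respect to the information measure `μ` on ensembles: the
concealing condition reads `μ {2^(-n), ρ_x} ≤ b`. -/
structure IsQBSCWith (μ : (Str n → ℝ) → (Str n → Matrix B B ℂ) → ℝ)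
    (P : Protocol n A B C) (a b : ℝ) : Prop where
  correct : P.IsCorrect
  concealing : μ (fun _ => ((2 : ℝ) ^ n)⁻¹) P.commitState ≤ b
  binding : P.IsBinding a

/-- `P` is an `(n, a, b)`-QBSC_ξ. -/
def IsQBSCXi (P : Protocol n A B C) (a b : ℝ) : Prop := IsQBSCWith xi P a b

end Protocol

end QBSC

/-! The constant `c` is not needed: every QBSC_ξ satisfies `n ≤ a + b`, and the statement follows
because `c > 0`.

Put `t_x = Tr (ρ^(-1/2) ρ_x)²`. Then `2^ξ` is the average of the `t_x` (`xi_eq`), and it is also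
Bob's summed success with the pretty good measurement (`prob_prettyGood`). Concealing therefore
implies `ξ ≤ b`.

For the bound, Alice commits to a uniform superposition of all strings, keeping a copy of the string
in an extra register; Bob then holds the mean state `ρ`. To open `x`, she rotates this purification
of `ρ` towards the honest commitment to `x`, a purification of `ρ_x`, and continues honestly. As in
Uhlmann's theorem, the overlap can be made at least `Tr (√ρ_x √ρ)` (`exists_unitary_overlap`). Two
applications of Cauchy–Schwarz bound the square of this from below by `1 / t_x`
(`one_le_overlap_sq_mul_collision`). Joint unitary evolution preserves overlaps and the honest
opening is accepted with certainty, so `x` is accepted with probability at least `1 / t_x`. Summing,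
`2^a ≥ ∑ 1 / t_x ≥ 4^n / ∑ t_x ≥ 2^(n - b)`.

The rotation needs a reveal round. Without one, correctness makes the `ρ_x` perfectly
distinguishable, so every `t_x` is `2^n` and `b ≥ n`, while `a ≥ 0` always. -/

namespace Matrix

/-! ### Polar decomposition and trace inequalities. -/

variable {m k : Type*} [Fintype m] [Fintype k]

/-- Two square matrices with the same Gram matrix differ by a unitary. -/
theorem exists_unitary_mul_of_gram_eq [DecidableEq m] {M P : Matrix m m ℂ} (h : Mᴴ * M = Pᴴ * P) :
    ∃ Q ∈ unitaryGroup m ℂ, M = Q * P := by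
  set f := toEuclideanCLM (n := m) (𝕜 := ℂ) P with hf
  set g := toEuclideanCLM (n := m) (𝕜 := ℂ) M with hg
  have hgf : star g * g = star f * f := by
    rw [hf, hg, ← map_star, ← map_star, ← map_mul, ← map_mul]
    exact congrArg _ h
  have hn : ∀ x, ‖g x‖ = ‖f x‖ := by
    intro x
    have h1 := ContinuousLinearMap.apply_norm_sq_eq_inner_adjoint_right g x
    have h2 := ContinuousLinearMap.apply_norm_sq_eq_inner_adjoint_right f x
    have h3 : (ContinuousLinearMap.adjoint g ∘L g) x = (ContinuousLinearMap.adjoint f ∘L f) x :=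
      congrArg (fun T => T x) hgf
    rw [h3, ← h2] at h1
    exact (sq_eq_sq₀ (norm_nonneg _) (norm_nonneg _)).1 h1
  obtain ⟨r, hr⟩ := LinearMap.exists_rightInverse_of_surjective f.toLinearMap.rangeRestrict
    f.toLinearMap.range_rangeRestrict
  have hr' : ∀ y, f (r y) = y := fun y => congrArg Subtype.val (LinearMap.congr_fun hr y)
  -- Equal norms make `f x ↦ g x` a well-defined isometry on the range of `f`; in finite dimension
  -- it extends to a unitary.
  let L : LinearMap.range f.toLinearMap →ₗᵢ[ℂ] EuclideanSpace ℂ m :=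
    { toLinearMap := g.toLinearMap ∘ₗ r
      norm_map' := fun y => by
        change ‖g (r y)‖ = ‖y‖
        rw [hn, hr']
        rfl }
  let u : EuclideanSpace ℂ m →L[ℂ] EuclideanSpace ℂ m := L.extend.toContinuousLinearMap
  have hu : star u * u = 1 :=
    (ContinuousLinearMap.norm_map_iff_adjoint_comp_self u).1 fun x => L.extend.norm_map x
  have huf : g = u * f := by
    ext1 x
    have hx : f x ∈ LinearMap.range f.toLinearMap := ⟨x, rfl⟩
    have h1 : u (f x) = g (r ⟨f x, hx⟩) := L.extend_apply ⟨f x, hx⟩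
    have h2 : g (r ⟨f x, hx⟩ - x) = 0 := by
      rw [← norm_eq_zero, hn, map_sub, hr', sub_self, norm_zero]
    rw [map_sub, sub_eq_zero] at h2
    exact h2.symm.trans h1.symm
  refine ⟨(toEuclideanCLM (n := m) (𝕜 := ℂ)).symm u, ?_, ?_⟩
  · rw [mem_unitaryGroup_iff']
    apply (toEuclideanCLM (n := m) (𝕜 := ℂ)).injective
    change toEuclideanCLM (n := m) (𝕜 := ℂ) _ = toEuclideanCLM (n := m) (𝕜 := ℂ) _
    rw [map_mul, map_star, StarAlgEquiv.apply_symm_apply, hu, map_one]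
  · apply (toEuclideanCLM (n := m) (𝕜 := ℂ)).injective
    change toEuclideanCLM (n := m) (𝕜 := ℂ) _ = toEuclideanCLM (n := m) (𝕜 := ℂ) _
    rw [map_mul, StarAlgEquiv.apply_symm_apply]
    exact huf

open scoped MatrixOrder in
/-- Polar decomposition of a square matrix. -/
theorem exists_polar [DecidableEq m] (M : Matrix m m ℂ) :
    ∃ Q ∈ unitaryGroup m ℂ, ∃ P : Matrix m m ℂ, P.PosSemidef ∧ M = Q * P := by
  have h0 : 0 ≤ Mᴴ * M := (posSemidef_conjTranspose_mul_self M).nonneg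
  have hP : (CFC.sqrt (Mᴴ * M)).PosSemidef := nonneg_iff_posSemidef.1 (CFC.sqrt_nonneg _)
  obtain ⟨Q, hQ, h⟩ := exists_unitary_mul_of_gram_eq (M := M) (P := CFC.sqrt (Mᴴ * M))
    (by rw [hP.isHermitian.eq, CFC.sqrt_mul_sqrt_self _ h0])
  exact ⟨Q, hQ, _, hP, h⟩

open scoped MatrixOrder in
theorem PosSemidef.exists_eq_conjTranspose_mul {A : Matrix m m ℂ} (hA : A.PosSemidef) :
    ∃ R : Matrix m m ℂ, A = Rᴴ * R := by
  classical
  exact CStarAlgebra.nonneg_iff_eq_star_mul_self.mp hA.nonneg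

theorem PosSemidef.re_trace_nonneg {A : Matrix m m ℂ} (hA : A.PosSemidef) : 0 ≤ A.trace.re :=
  (Complex.le_def.1 hA.trace_nonneg).1

theorem PosSemidef.re_trace_mul_nonneg {A B : Matrix m m ℂ} (hA : A.PosSemidef)
    (hB : B.PosSemidef) : 0 ≤ (A * B).trace.re := by
  obtain ⟨R, rfl⟩ := hA.exists_eq_conjTranspose_mul
  rw [Matrix.mul_assoc, trace_mul_comm]
  exact (hB.mul_mul_conjTranspose_same R).re_trace_nonneg

/-- With `A = Rᴴ R` and `B = Sᴴ S` the trace is the squared Hilbert–Schmidt norm of `R Sᴴ`, a factor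
of `A B`. -/
theorem PosSemidef.mul_eq_zero_of_re_trace {A B : Matrix m m ℂ} (hA : A.PosSemidef)
    (hB : B.PosSemidef) (h : (A * B).trace.re = 0) : A * B = 0 := by
  obtain ⟨R, rfl⟩ := hA.exists_eq_conjTranspose_mul
  obtain ⟨S, rfl⟩ := hB.exists_eq_conjTranspose_mul
  have h1 : (Rᴴ * R * (Sᴴ * S)).trace = ((R * Sᴴ) * (R * Sᴴ)ᴴ).trace := by
    rw [Matrix.mul_assoc, trace_mul_comm, conjTranspose_mul, conjTranspose_conjTranspose]
    simp only [Matrix.mul_assoc]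
  have h2 : ((R * Sᴴ) * (R * Sᴴ)ᴴ).trace = 0 := by
    apply Complex.ext
    · rw [← h1, h]; rfl
    · exact (Complex.le_def.1 (posSemidef_self_mul_conjTranspose (R * Sᴴ)).trace_nonneg).2.symm
  have h3 := trace_mul_conjTranspose_self_eq_zero_iff.1 h2
  rw [Matrix.mul_assoc, ← Matrix.mul_assoc R, h3, Matrix.zero_mul, Matrix.mul_zero]

theorem re_trace_conjTranspose (A : Matrix m m ℂ) : Aᴴ.trace.re = A.trace.re := by
  rw [trace_conjTranspose]; simp

/-- Cauchy–Schwarz for the semi-inner product `Tr (Uᴴ A V)` weighted by `D`. -/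
theorem PosSemidef.sq_re_trace_le {A : Matrix m m ℂ} (hA : A.PosSemidef) {D : Matrix k k ℂ}
    (hD : D.PosSemidef) (U V : Matrix m k ℂ) :
    (D * (Uᴴ * A * V)).trace.re ^ 2 ≤
      (D * (Uᴴ * A * U)).trace.re * (D * (Vᴴ * A * V)).trace.re := by
  have hc : (D * (Vᴴ * A * U)).trace.re = (D * (Uᴴ * A * V)).trace.re := by
    rw [← re_trace_conjTranspose]
    simp only [conjTranspose_mul, conjTranspose_conjTranspose, hA.isHermitian.eq,
      hD.isHermitian.eq]
    rw [trace_mul_comm, ← Matrix.mul_assoc Uᴴ]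
  -- The quadratic is the form evaluated at `U + t V`. Only real parts are compared, so real `t`
  -- suffices and the discriminant gives the claim.
  have key : ∀ t : ℝ, 0 ≤ (D * (Vᴴ * A * V)).trace.re * (t * t)
      + 2 * (D * (Uᴴ * A * V)).trace.re * t + (D * (Uᴴ * A * U)).trace.re := by
    intro t
    have h := hD.re_trace_mul_nonneg (hA.conjTranspose_mul_mul_same (U + (t : ℂ) • V))
    have e : (D * ((U + (t : ℂ) • V)ᴴ * A * (U + (t : ℂ) • V))).trace =
        (t * t : ℝ) • (D * (Vᴴ * A * V)).trace + t • (D * (Uᴴ * A * V)).trace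
        + t • (D * (Vᴴ * A * U)).trace + (D * (Uᴴ * A * U)).trace := by
      simp only [conjTranspose_add, conjTranspose_smul, Matrix.mul_add, Matrix.add_mul,
        Matrix.smul_mul, Matrix.mul_smul, trace_add, trace_smul, Complex.real_smul, smul_eq_mul,
        Complex.star_def, Complex.conj_ofReal]
      push_cast; ring
    rw [e] at h
    simp only [Complex.add_re, Complex.smul_re, smul_eq_mul, hc] at h
    linarith
  have := discrim_le_zero key
  rw [discrim] at this
  nlinarith

/-- Trace duality between contractions and positive semidefinite matrices. -/
theorem re_trace_contraction_mul_le [DecidableEq m] {C P : Matrix m m ℂ} (hC : (1 - Cᴴ * C).PosSemidef)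
    (hP : P.PosSemidef) : (P * C).trace.re ≤ P.trace.re := by
  -- Expanding `Tr P (1 - C)ᴴ (1 - C) ≥ 0` and adding `Tr P (1 - Cᴴ C) ≥ 0` cancels the quadratic
  -- term.
  have h1 := hP.re_trace_mul_nonneg (posSemidef_conjTranspose_mul_self (1 - C))
  have h2 := hP.re_trace_mul_nonneg hC
  have h3 : (P * Cᴴ).trace.re = (P * C).trace.re := by
    rw [← re_trace_conjTranspose, conjTranspose_mul, conjTranspose_conjTranspose,
      hP.isHermitian.eq, trace_mul_comm]
  simp only [conjTranspose_sub, conjTranspose_one, Matrix.mul_sub, Matrix.sub_mul, Matrix.mul_one,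
    Matrix.one_mul, trace_sub, Complex.sub_re] at h1 h2
  linarith

theorem posSemidef_of_isHermitian_idem {A : Matrix m m ℂ} (h : A.IsHermitian) (h2 : A * A = A) :
    A.PosSemidef := by
  have := posSemidef_conjTranspose_mul_self A
  rwa [h.eq, h2] at this

theorem posSemidef_one_sub_of_isHermitian_idem [DecidableEq m] {A : Matrix m m ℂ}
    (h : A.IsHermitian) (h2 : A * A = A) : (1 - A).PosSemidef := by
  apply posSemidef_of_isHermitian_idem
  · exact isHermitian_one.sub h
  · simp [Matrix.mul_sub, Matrix.sub_mul, h2]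

/-- A matrix that fixes `X Xᴴ` from the left fixes `X`. -/
theorem mul_eq_self_of_mul_gram [DecidableEq m] {p : Matrix m m ℂ} {X : Matrix m k ℂ}
    (hX : p * (X * Xᴴ) = X * Xᴴ) : p * X = X := by
  have : (1 - p) * X = 0 := by
    rw [← self_mul_conjTranspose_eq_zero, conjTranspose_mul, Matrix.mul_assoc, ← Matrix.mul_assoc X,
      ← Matrix.mul_assoc, Matrix.sub_mul, hX, Matrix.one_mul, sub_self, Matrix.zero_mul]
  rw [Matrix.sub_mul, Matrix.one_mul, sub_eq_zero] at this
  exact this.symm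

/-! ### Pseudo-inverse square roots and overlaps of purifications. -/

/-- `s` is a positive semidefinite square root of `ρ` and `r` the pseudo-inverse of `s`. -/
structure IsSqrtPair (ρ s r : Matrix m m ℂ) : Prop where
  posSemidef : s.PosSemidef
  posSemidef_inv : r.PosSemidef
  mul_self : s * s = ρ
  comm : s * r = r * s
  sqrt_inv_sqrt : s * r * s = s
  inv_sqrt_inv : r * s * r = r

/-- The spectrum is finite, so every real function is continuous on it and the identities reduce to
scalar ones; the convention `0⁻¹ = 0` realises the inverse on the support. -/
theorem PosSemidef.isSqrtPair [DecidableEq m] {ρ : Matrix m m ℂ} (hρ : ρ.PosSemidef) :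
    IsSqrtPair ρ (cfc Real.sqrt ρ) (QBSC.invSqrt ρ) := by
  have hsa : IsSelfAdjoint ρ := hρ.isHermitian
  have hc : ∀ f : ℝ → ℝ, ContinuousOn f (spectrum ℝ ρ) := fun f =>
    (finite_real_spectrum (A := ρ)).continuousOn f
  have hpos : ∀ f : ℝ → ℝ, (∀ t, 0 ≤ f t) → (cfc f ρ).PosSemidef := by
    intro f hf
    have e : cfc f ρ = (cfc (fun t => Real.sqrt (f t)) ρ)ᴴ * cfc (fun t => Real.sqrt (f t)) ρ := by
      rw [← star_eq_conjTranspose, (cfc_predicate (fun t => Real.sqrt (f t)) ρ).star_eq,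
        ← cfc_mul _ _ ρ (hc _) (hc _)]
      exact cfc_congr fun t _ => (Real.mul_self_sqrt (hf t)).symm
    rw [e]; exact posSemidef_conjTranspose_mul_self _
  have hspec : ∀ t ∈ spectrum ℝ ρ, 0 ≤ t := by
    intro t ht
    rw [hρ.isHermitian.spectrum_real_eq_range_eigenvalues] at ht
    obtain ⟨i, rfl⟩ := ht
    exact hρ.eigenvalues_nonneg i
  unfold QBSC.invSqrt
  refine ⟨hpos _ Real.sqrt_nonneg, hpos _ fun t => inv_nonneg.2 (Real.sqrt_nonneg t), ?_,
    cfc_commute_cfc _ _ _, ?_, ?_⟩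
  · rw [← cfc_mul _ _ ρ (hc _) (hc _)]
    conv_rhs => rw [← cfc_id' ℝ ρ]
    exact cfc_congr fun t ht => Real.mul_self_sqrt (hspec t ht)
  · rw [← cfc_mul _ _ ρ (hc _) (hc _), ← cfc_mul _ _ ρ (hc _) (hc _)]
    exact cfc_congr fun t _ => mul_inv_mul_cancel (Real.sqrt t)
  · rw [← cfc_mul _ _ ρ (hc _) (hc _), ← cfc_mul _ _ ρ (hc _) (hc _)]
    refine cfc_congr fun t _ => ?_
    have := mul_inv_mul_cancel (Real.sqrt t)⁻¹
    rwa [inv_inv] at this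

namespace IsSqrtPair

variable {ρ s r : Matrix m m ℂ}

theorem proj_isHermitian (h : IsSqrtPair ρ s r) : (s * r).IsHermitian := by
  rw [IsHermitian, conjTranspose_mul, h.posSemidef.isHermitian.eq,
    h.posSemidef_inv.isHermitian.eq, h.comm]

theorem proj_idem (h : IsSqrtPair ρ s r) : s * r * (s * r) = s * r := by
  rw [← Matrix.mul_assoc, h.sqrt_inv_sqrt]

theorem inv_mul_mul_inv (h : IsSqrtPair ρ s r) : r * ρ * r = s * r := by
  rw [← h.mul_self, ← Matrix.mul_assoc, ← h.comm, h.sqrt_inv_sqrt]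

theorem proj_mul (h : IsSqrtPair ρ s r) : s * r * ρ = ρ := by
  rw [← h.mul_self, ← Matrix.mul_assoc, h.sqrt_inv_sqrt]

end IsSqrtPair

/-- Purifications `X`, `Y` of `ρ`, `σ` can be aligned by a unitary on the purifying system so
that their overlap is at least `Tr (√σ √ρ)`. -/
theorem exists_unitary_overlap [DecidableEq m] [DecidableEq k]
    {ρ s r σ a q : Matrix m m ℂ} (hρ : IsSqrtPair ρ s r)
    (hσ : IsSqrtPair σ a q) {X Y : Matrix m k ℂ} (hX : X * Xᴴ = ρ) (hY : Y * Yᴴ = σ) :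
    ∃ U ∈ unitaryGroup k ℂ, (a * s).trace.re ≤ (Yᴴ * (X * U)).trace.re := by
  obtain ⟨Q, hQ, P, hP, hM⟩ := exists_polar (Yᴴ * X)
  -- Undoing the unitary polar factor of `Yᴴ X` turns the overlap into `Tr P`, the trace norm.
  refine ⟨Qᴴ, Unitary.star_mem hQ, ?_⟩
  have hQ1 : Qᴴ * Q = 1 := mem_unitaryGroup_iff'.1 hQ
  have e1 : (Yᴴ * (X * Qᴴ)).trace = P.trace := by
    rw [← Matrix.mul_assoc, hM, Matrix.mul_assoc, trace_mul_comm, Matrix.mul_assoc, hQ1, Matrix.mul_one]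
  rw [e1]
  -- `W` and `V` are the partial isometries in the polar forms `X = s W` and `Y = a V`; `W Wᴴ` and
  -- `V Vᴴ` are the support projections of `ρ` and `σ`.
  set W := r * X with hW
  set V := q * Y with hV
  have hr := hρ.posSemidef_inv.isHermitian.eq
  have hq := hσ.posSemidef_inv.isHermitian.eq
  have hWW : W * Wᴴ = s * r := by
    rw [hW, conjTranspose_mul, hr, Matrix.mul_assoc, ← Matrix.mul_assoc X, hX, ← Matrix.mul_assoc,
      hρ.inv_mul_mul_inv]
  have hVV : V * Vᴴ = a * q := by
    rw [hV, conjTranspose_mul, hq, Matrix.mul_assoc, ← Matrix.mul_assoc Y, hY, ← Matrix.mul_assoc,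
      hσ.inv_mul_mul_inv]
  have hsW : s * W = X := by
    rw [hW, ← Matrix.mul_assoc]
    exact mul_eq_self_of_mul_gram (by rw [hX, hρ.proj_mul])
  have haV : a * V = Y := by
    rw [hV, ← Matrix.mul_assoc]
    exact mul_eq_self_of_mul_gram (by rw [hY, hσ.proj_mul])
  have hVid : Vᴴ * V * (Vᴴ * V) = Vᴴ * V := by
    have : V * Vᴴ * V = V := by
      rw [hVV, hV, ← Matrix.mul_assoc, hσ.comm, hσ.inv_sqrt_inv]
    rw [Matrix.mul_assoc, ← Matrix.mul_assoc V, this]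
  have hsup : (1 - s * r).PosSemidef :=
    posSemidef_one_sub_of_isHermitian_idem hρ.proj_isHermitian hρ.proj_idem
  have hVc : (1 - Vᴴ * V).PosSemidef :=
    posSemidef_one_sub_of_isHermitian_idem (isHermitian_conjTranspose_mul_self V) hVid
  -- the contraction aligning the two purifications
  have hC : (1 - (Wᴴ * V * Q)ᴴ * (Wᴴ * V * Q)).PosSemidef := by
    have e : 1 - (Wᴴ * V * Q)ᴴ * (Wᴴ * V * Q) =
        Qᴴ * (1 - Vᴴ * V) * Q + Qᴴ * (Vᴴ * (1 - s * r) * V) * Q := by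
      rw [← hWW]
      simp only [conjTranspose_mul, conjTranspose_conjTranspose, Matrix.mul_sub, Matrix.sub_mul,
        Matrix.mul_one, hQ1, Matrix.mul_assoc]
      abel
    rw [e]
    exact (hVc.conjTranspose_mul_mul_same Q).add
      ((hsup.conjTranspose_mul_mul_same V).conjTranspose_mul_mul_same Q)
  refine le_trans (le_of_eq ?_) (re_trace_contraction_mul_le hC hP)
  congr 1
  have hss : s * (s * r) = s := by rw [hρ.comm, ← Matrix.mul_assoc, hρ.sqrt_inv_sqrt]
  calc (a * s).trace = (V * (Vᴴ * (a * (s * (W * Wᴴ))))).trace := by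
        rw [← Matrix.mul_assoc, hVV, hWW, hss, ← Matrix.mul_assoc, hσ.sqrt_inv_sqrt]
    _ = ((a * V)ᴴ * (s * W) * (Wᴴ * V)).trace := by
        rw [conjTranspose_mul a, hσ.posSemidef.isHermitian.eq, trace_mul_comm V]
        simp only [Matrix.mul_assoc]
    _ = (Q * P * (Wᴴ * V)).trace := by rw [haV, hsW, hM]
    _ = (P * (Wᴴ * V * Q)).trace := by rw [Matrix.mul_assoc, trace_mul_comm]; simp only [Matrix.mul_assoc]

/-- The overlap `Tr (√σ √ρ)` is bounded below by the collision quantity `Tr (ρ^(-1/2) σ)²`. -/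
theorem one_le_overlap_sq_mul_collision [DecidableEq m] {ρ s r σ a q : Matrix m m ℂ} (hρ : IsSqrtPair ρ s r)
    (hσ : IsSqrtPair σ a q) (hsupp : s * r * σ = σ) (htr : σ.trace.re = 1) :
    1 ≤ (a * s).trace.re ^ 2 * (r * σ * (r * σ)).trace.re := by
  have ha := hσ.posSemidef.isHermitian.eq
  have hr := hρ.posSemidef_inv.isHermitian.eq
  have haa : s * r * a = a := mul_eq_self_of_mul_gram (by rw [ha, hσ.mul_self, hsupp])
  have haa' : a * s * r = a := by
    have := congrArg conjTranspose haa
    rwa [conjTranspose_mul, hρ.proj_isHermitian.eq, ha, ← Matrix.mul_assoc] at this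
  -- With `u = Tr (a (a r a))`, the first Cauchy–Schwarz gives `1 = (Tr σ)² ≤ Tr (a s) u`; the
  -- second gives `u² ≤ Tr σ · Tr (r σ)²`.
  have h1 := hρ.posSemidef.sq_re_trace_le hσ.posSemidef (1 : Matrix m m ℂ) (r * a)
  have h2 := PosSemidef.one.sq_re_trace_le PosSemidef.one a (a * r * a)
  have e1 : a * ((1 : Matrix m m ℂ)ᴴ * s * (r * a)) = σ := by
    rw [conjTranspose_one, Matrix.one_mul, ← Matrix.mul_assoc s, haa, hσ.mul_self]
  have e2 : a * ((1 : Matrix m m ℂ)ᴴ * s * 1) = a * s := by simp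
  have e3 : a * ((r * a)ᴴ * s * (r * a)) = a * (a * r * a) := by
    rw [conjTranspose_mul, ha, hr]
    congr 1
    rw [Matrix.mul_assoc a, Matrix.mul_assoc a, Matrix.mul_assoc r, ← Matrix.mul_assoc s, haa, Matrix.mul_assoc]
  rw [e1, e2, e3, htr] at h1
  simp only [Matrix.one_mul, Matrix.mul_one, conjTranspose_mul, ha, hr] at h2
  have e4 : (a * (r * a) * (a * r * a)).trace = (r * σ * (r * σ)).trace := by
    rw [← hσ.mul_self]
    simp only [Matrix.mul_assoc]
    rw [trace_mul_comm]; simp only [Matrix.mul_assoc]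
  rw [e4, hσ.mul_self, htr, one_mul] at h2
  set t := (a * s).trace.re
  set u := (a * (a * r * a)).trace.re
  calc (1 : ℝ) ≤ (t * u) ^ 2 := by nlinarith
    _ = t ^ 2 * u ^ 2 := mul_pow _ _ _
    _ ≤ _ := by gcongr

end Matrix

namespace QBSC

open Matrix

/-! ### Joint vectors, their overlaps and their evolution. -/

section States

set_option linter.unusedSectionVars false

universe u v w

variable {X : Type*} {A : Type u} {B : Type v} {C : Type w}
  [Fintype X] [Fintype A] [Fintype B] [Fintype C]

/-- A joint vector as a matrix from Alice's system and the channel to Bob's system. -/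
def bobMatrix (ψ : A × B × C → ℂ) : Matrix B (A × C) ℂ := fun b e => ψ (e.1, b, e.2)

/-- A joint vector as a matrix from Bob's system and the channel to Alice's system. -/
def aliceMatrix (ψ : A × B × C → ℂ) : Matrix A (B × C) ℂ := fun a e => ψ (a, e)

/-- The inner product of two joint vectors. -/
def overlap (φ ψ : A × B × C → ℂ) : ℂ := ((bobMatrix φ)ᴴ * bobMatrix ψ).trace

theorem bobState_eq (ψ : A × B × C → ℂ) : bobState ψ = bobMatrix ψ * (bobMatrix ψ)ᴴ := by
  ext b b'
  simp [bobState, bobMatrix, mul_apply, Fintype.sum_prod_type]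

theorem bobMatrix_injective :
    Function.Injective (bobMatrix : (A × B × C → ℂ) → Matrix B (A × C) ℂ) := by
  intro φ ψ h
  ext ⟨a, b, c⟩
  exact congrFun (congrFun h b) (a, c)

theorem overlap_eq_sum (φ ψ : A × B × C → ℂ) :
    overlap φ ψ = ∑ a, ∑ b, ∑ c, star (φ (a, b, c)) * ψ (a, b, c) := by
  simp only [overlap, bobMatrix, trace, diag_apply, mul_apply, conjTranspose_apply,
    Fintype.sum_prod_type]
  exact Finset.sum_congr rfl fun _ _ => Finset.sum_comm

/-- The inner product does not depend on how the tensor factors are grouped; this grouping makes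
Bob's unitary a right multiplication, as `bobMatrix` does for Alice's. -/
theorem overlap_eq_trace_aliceMatrix (φ ψ : A × B × C → ℂ) :
    overlap φ ψ = ((aliceMatrix φ)ᴴ * aliceMatrix ψ).trace := by
  rw [overlap_eq_sum]
  simp only [aliceMatrix, trace, diag_apply, mul_apply, conjTranspose_apply,
    Fintype.sum_prod_type]
  rw [Finset.sum_comm]
  exact Finset.sum_congr rfl fun _ _ => Finset.sum_comm

theorem trace_bobState (ψ : A × B × C → ℂ) : (bobState ψ).trace = overlap ψ ψ := by
  rw [bobState_eq, trace_mul_comm, overlap]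

theorem posSemidef_bobState (ψ : A × B × C → ℂ) : (bobState ψ).PosSemidef := by
  rw [bobState_eq]; exact posSemidef_self_mul_conjTranspose _

theorem bobState_smul (t : ℂ) (ψ : A × B × C → ℂ) :
    bobState (t • ψ) = (t * star t) • bobState ψ := by
  ext b b'
  rw [Matrix.smul_apply]
  simp only [bobState, Pi.smul_apply, smul_eq_mul, Finset.mul_sum, star_mul']
  exact Finset.sum_congr rfl fun _ _ => Finset.sum_congr rfl fun _ _ => by ring

/-- The joint vector `∑ x, |x⟩ ⊗ ψ x`, Alice holding an additional register with basis `X`. -/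
def bundle (ψ : X → A × B × C → ℂ) : (X × A) × B × C → ℂ := fun i => ψ i.1.1 (i.1.2, i.2)

theorem bobState_bundle (ψ : X → A × B × C → ℂ) : bobState (bundle ψ) = ∑ x, bobState (ψ x) := by
  ext b b'
  simp [bobState, bundle, Matrix.sum_apply, Fintype.sum_prod_type]

theorem IsPure.sum_star_mul_self {Y : Type*} [Fintype Y] {f : Y → ℂ} (hf : IsPure f) :
    ∑ i, star (f i) * f i = 1 := by
  have : ∀ i, star (f i) * f i = ((‖f i‖ ^ 2 : ℝ) : ℂ) := fun i => by
    rw [Complex.star_def, Complex.conj_mul']; push_cast; rfl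
  simp_rw [this]
  rw [← Complex.ofReal_sum, hf, Complex.ofReal_one]

theorem overlap_productVec_self {α : A → ℂ} {β : B → ℂ} {κ : C → ℂ} (hα : IsPure α)
    (hβ : IsPure β) (hκ : IsPure κ) :
    overlap (productVec α β κ) (productVec α β κ) = 1 := by
  have e : ∀ a b c, star (productVec α β κ (a, b, c)) * productVec α β κ (a, b, c) =
      star (α a) * α a * (star (β b) * β b * (star (κ c) * κ c)) := by
    intro a b c
    simp only [productVec, star_mul']
    ring
  simp_rw [overlap_eq_sum, e, ← Finset.mul_sum, ← Finset.sum_mul, hα.sum_star_mul_self,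
    hβ.sum_star_mul_self, hκ.sum_star_mul_self, mul_one]

variable [DecidableEq A] [DecidableEq B] [DecidableEq C]

theorem bobMatrix_aliceAct (U : Matrix.unitaryGroup (A × C) ℂ) (ψ : A × B × C → ℂ) :
    bobMatrix (aliceAct U ψ) = bobMatrix ψ * (U : Matrix (A × C) (A × C) ℂ)ᵀ := by
  ext b e
  simp [bobMatrix, aliceAct, mul_apply, mul_comm]

theorem aliceMatrix_bobAct (V : Matrix.unitaryGroup (B × C) ℂ) (ψ : A × B × C → ℂ) :
    aliceMatrix (bobAct V ψ) = aliceMatrix ψ * (V : Matrix (B × C) (B × C) ℂ)ᵀ := by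
  ext a e
  simp [aliceMatrix, bobAct, mul_apply, mul_comm]

theorem trace_gram_mul_unitary {m k : Type*} [Fintype m] [Fintype k] [DecidableEq k]
    (M N : Matrix m k ℂ) (U : Matrix.unitaryGroup k ℂ) :
    ((M * (U : Matrix k k ℂ)ᵀ)ᴴ * (N * (U : Matrix k k ℂ)ᵀ)).trace = (Mᴴ * N).trace := by
  have hU : (U : Matrix k k ℂ)ᵀ * (U : Matrix k k ℂ)ᵀᴴ = 1 :=
    mem_unitaryGroup_iff.1 (transpose_mem_unitaryGroup_iff.2 U.2)
  rw [conjTranspose_mul, Matrix.mul_assoc, trace_mul_comm, Matrix.mul_assoc, Matrix.mul_assoc, hU,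
    Matrix.mul_one]

theorem overlap_evolve (U : ℕ → Matrix.unitaryGroup (A × C) ℂ)
    (V : ℕ → Matrix.unitaryGroup (B × C) ℂ) (φ ψ : A × B × C → ℂ) (k : ℕ) :
    overlap (evolve U V φ k) (evolve U V ψ k) = overlap φ ψ := by
  induction k with
  | zero => rfl
  | succ k ih =>
    rw [← ih]
    simp only [evolve]
    rw [overlap_eq_trace_aliceMatrix, aliceMatrix_bobAct, aliceMatrix_bobAct, trace_gram_mul_unitary, ← overlap_eq_trace_aliceMatrix,
      overlap, bobMatrix_aliceAct, bobMatrix_aliceAct, trace_gram_mul_unitary, overlap]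

theorem aliceAct_mul (U U' : Matrix.unitaryGroup (A × C) ℂ) (ψ : A × B × C → ℂ) :
    aliceAct (U * U') ψ = aliceAct U (aliceAct U' ψ) := by
  apply bobMatrix_injective
  simp only [bobMatrix_aliceAct, Submonoid.coe_mul, transpose_mul, Matrix.mul_assoc]

/-- A unitary that Alice applies right before the first round can be merged into it. -/
theorem evolve_merge (U : ℕ → Matrix.unitaryGroup (A × C) ℂ)
    (V : ℕ → Matrix.unitaryGroup (B × C) ℂ) (U' : Matrix.unitaryGroup (A × C) ℂ)
    (ψ : A × B × C → ℂ) (k : ℕ) :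
    evolve (fun i => if i = 0 then U 0 * U' else U i) V ψ (k + 1) =
      evolve U V (aliceAct U' ψ) (k + 1) := by
  induction k with
  | zero => simp [evolve, aliceAct_mul]
  | succ k ih =>
    rw [evolve, ih]
    simp [evolve]

theorem evolve_smul (U : ℕ → Matrix.unitaryGroup (A × C) ℂ)
    (V : ℕ → Matrix.unitaryGroup (B × C) ℂ) (t : ℂ) (ψ : A × B × C → ℂ) (k : ℕ) :
    evolve U V (t • ψ) k = t • evolve U V ψ k := by
  induction k with
  | zero => rfl
  | succ k ih =>
    ext i
    simp only [evolve, ih, bobAct, aliceAct, Pi.smul_apply, smul_eq_mul, Finset.mul_sum]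
    exact Finset.sum_congr rfl fun _ _ => Finset.sum_congr rfl fun _ _ => by ring

theorem evolve_zero_vec (U : ℕ → Matrix.unitaryGroup (A × C) ℂ)
    (V : ℕ → Matrix.unitaryGroup (B × C) ℂ) (k : ℕ) :
    evolve U V (0 : A × B × C → ℂ) k = 0 := by
  have := evolve_smul U V 0 0 k
  simpa using this

/-- Alice's unitary acting trivially on an additional register with basis `X`. -/
def liftUnitary (X : Type*) [Fintype X] [DecidableEq X]
    (U : Matrix.unitaryGroup (A × C) ℂ) :
    Matrix.unitaryGroup ((X × A) × C) ℂ :=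
  ⟨((1 : Matrix X X ℂ) ⊗ₖ (U : Matrix (A × C) (A × C) ℂ)).submatrix
      (Equiv.prodAssoc X A C) (Equiv.prodAssoc X A C), by
    have h := mem_unitaryGroup_iff.1
      (kronecker_mem_unitary (one_mem (Matrix.unitaryGroup X ℂ)) U.2)
    rw [mem_unitaryGroup_iff, star_eq_conjTranspose, conjTranspose_submatrix,
      submatrix_mul_equiv, ← star_eq_conjTranspose, h, submatrix_one_equiv]⟩

/-- Nobody acts on the extra register, so its branches evolve independently. The branches need not
be normalised, which allows scaled and zero ones. -/
theorem evolve_bundle [DecidableEq X] (U : ℕ → Matrix.unitaryGroup (A × C) ℂ)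
    (V : ℕ → Matrix.unitaryGroup (B × C) ℂ) (ψ : X → A × B × C → ℂ) (k : ℕ) :
    evolve (fun i => liftUnitary X (U i)) V (bundle ψ) k =
      bundle fun x => evolve U V (ψ x) k := by
  induction k with
  | zero => rfl
  | succ k ih =>
    have h : ∀ χ : X → A × B × C → ℂ,
        aliceAct (liftUnitary X (U k)) (bundle χ) = bundle fun x => aliceAct (U k) (χ x) := by
      intro χ
      ext ⟨⟨x, a⟩, b, c⟩
      simp [aliceAct, bundle, liftUnitary, Fintype.sum_prod_type, one_apply, ite_mul]
    rw [evolve, ih, h]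
    rfl

end States

/-! ### Measurements and certain outcomes. -/

section Measurements

variable {X : Type*} [Fintype X] {B : Type*} [Fintype B] [DecidableEq B]

theorem Measurement.posSemidef_one_sub [DecidableEq X] (M : Measurement X B) (x : X) :
    (1 - M.op x).PosSemidef := by
  have : 1 - M.op x = ∑ y ∈ Finset.univ.erase x, M.op y := by
    rw [← M.sum_eq_one, ← Finset.add_sum_erase _ _ (Finset.mem_univ x), add_sub_cancel_left]
  rw [this]
  exact posSemidef_sum _ fun y _ => M.posSemidef y

theorem Measurement.prob_nonneg (M : Measurement X B) {ρ : Matrix B B ℂ} (hρ : ρ.PosSemidef)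
    (x : X) : 0 ≤ M.prob ρ x :=
  (M.posSemidef x).re_trace_mul_nonneg hρ

/-- If outcome `x` is certain in the state `φ`, it has probability at least the squared overlap
with `φ` in any other state. -/
theorem Measurement.sq_overlap_le_prob [DecidableEq X] (M : Measurement X B) {A C : Type*}
    [Fintype A] [Fintype C] {φ ψ : A × B × C → ℂ} {x : X}
    (hφ : overlap φ φ = 1) (h : M.prob (bobState φ) x = 1) :
    (overlap φ ψ).re ^ 2 ≤ M.prob (bobState ψ) x := by
  classical
  have e : ∀ (N : Matrix B B ℂ) (χ : A × B × C → ℂ),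
      ((1 : Matrix (A × C) (A × C) ℂ) * ((bobMatrix χ)ᴴ * N * bobMatrix χ)).trace =
        (N * bobState χ).trace := by
    intro N χ
    rw [Matrix.one_mul, Matrix.mul_assoc, trace_mul_comm, bobState_eq, Matrix.mul_assoc]
  -- Cauchy–Schwarz for the effect `E = M.op x` bounds `Re ⟨φ|E|ψ⟩` by the outcome probabilities.
  -- For `1 - E`, whose expectation in `φ` is zero, it shows that `E` may be dropped from `Re
  -- ⟨φ|E|ψ⟩`.
  have h1 := (M.posSemidef x).sq_re_trace_le PosSemidef.one (bobMatrix φ) (bobMatrix ψ)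
  have h2 := (M.posSemidef_one_sub x).sq_re_trace_le PosSemidef.one (bobMatrix φ) (bobMatrix ψ)
  rw [e, e] at h1 h2
  have h3 : ((1 - M.op x) * bobState φ).trace.re = 0 := by
    rw [Matrix.sub_mul, Matrix.one_mul, trace_sub, trace_bobState, hφ, Complex.sub_re]
    unfold Measurement.prob at h
    rw [h]; simp
  rw [h3, zero_mul] at h2
  have h4 := pow_eq_zero_iff (two_ne_zero) |>.1 (le_antisymm h2 (sq_nonneg _))
  rw [Matrix.one_mul, Matrix.mul_sub, Matrix.sub_mul, Matrix.mul_one, trace_sub, Complex.sub_re,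
    sub_eq_zero] at h4
  unfold Measurement.prob at h ⊢
  rw [Matrix.one_mul, h, one_mul, ← h4] at h1
  exact h1

end Measurements

end QBSC

namespace QBSC

open Matrix

/-! ### Average states and the collision quantity. -/

section Ensembles

variable {X : Type*} [Fintype X] {B : Type*}

theorem posSemidef_averageState {p : X → ℝ} (hp : ∀ x, 0 ≤ p x) {ρ : X → Matrix B B ℂ}
    (hρ : ∀ x, (ρ x).PosSemidef) : (averageState p ρ).PosSemidef :=
  posSemidef_sum _ fun x _ => (hρ x).smul (by exact_mod_cast hp x)

variable [Fintype B] [DecidableEq B]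

/-- The support projection of the average state fixes every member of the ensemble. -/
theorem support_mul_of_averageState {p : X → ℝ} (hp : ∀ x, 0 < p x) {ρ : X → Matrix B B ℂ}
    (hρ : ∀ x, (ρ x).PosSemidef) {s r : Matrix B B ℂ} (h : IsSqrtPair (averageState p ρ) s r)
    (x : X) : s * r * ρ x = ρ x := by
  have hN : (1 - s * r).PosSemidef :=
    posSemidef_one_sub_of_isHermitian_idem h.proj_isHermitian h.proj_idem
  -- The average state has no weight off its support; as the terms are nonnegative and the weights
  -- positive, neither has any member.
  have h0 : ∑ x, p x * ((1 - s * r) * ρ x).trace.re = 0 := by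
    have e : (1 - s * r) * averageState p ρ = 0 := by
      rw [Matrix.sub_mul, h.proj_mul, Matrix.one_mul, sub_self]
    have e2 := congrArg (fun M => (trace M).re) e
    simpa [averageState, Matrix.mul_sum, trace_sum] using e2
  have h1 := (Finset.sum_eq_zero_iff_of_nonneg fun y _ =>
    mul_nonneg (hp y).le (hN.re_trace_mul_nonneg (hρ y))).1 h0 x (Finset.mem_univ x)
  have h2 := hN.mul_eq_zero_of_re_trace (hρ x) ((mul_eq_zero.1 h1).resolve_left (hp x).ne')
  rw [Matrix.sub_mul, Matrix.one_mul, sub_eq_zero] at h2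
  exact h2.symm

/-- The classical register makes the state block diagonal, so the cross terms of the square vanish.
-/
theorem trace_collision [DecidableEq X] (p : X → ℝ) (ρ : X → Matrix B B ℂ) (r : Matrix B B ℂ) :
    ((((1 : Matrix X X ℂ) ⊗ₖ r) * cqState p ρ) ^ 2).trace.re =
      ∑ x, p x ^ 2 * (r * ρ x * (r * ρ x)).trace.re := by
  have e : ((1 : Matrix X X ℂ) ⊗ₖ r) * cqState p ρ =
      ∑ x, (p x : ℂ) • (Matrix.single x x (1 : ℂ) ⊗ₖ (r * ρ x)) := by
    simp only [cqState, Matrix.mul_sum, Matrix.mul_smul, ← mul_kronecker_mul, Matrix.one_mul]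
  rw [e, sq, Finset.sum_mul_sum, trace_sum, Complex.re_sum]
  refine Finset.sum_congr rfl fun x _ => ?_
  rw [trace_sum, Finset.sum_eq_single x]
  · rw [Matrix.smul_mul, Matrix.mul_smul, ← mul_kronecker_mul, single_mul_single_same, trace_smul,
      trace_smul, trace_kronecker, trace_single_eq_same]
    simp only [smul_eq_mul, mul_one, one_mul, Complex.re_ofReal_mul]
    ring
  · intro y _ hy
    rw [Matrix.smul_mul, Matrix.mul_smul, ← mul_kronecker_mul,
      single_mul_single_of_ne _ _ _ _ hy.symm]
    simp
  · simp

end Ensembles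

/-! ### Affinity, collision quantities and the pretty good measurement. -/

namespace Protocol

universe u v w

variable {n : ℕ} {A : Type u} {B : Type v} {C : Type w}
  [Fintype A] [DecidableEq A] [Fintype B] [DecidableEq B] [Fintype C] [DecidableEq C]

/-- Bob's average state after the commit phase, the string being uniformly distributed. -/
noncomputable def meanState (P : Protocol n A B C) : Matrix B B ℂ :=
  averageState (fun _ => ((2 : ℝ) ^ n)⁻¹) P.commitState

/-- The collision quantity `Tr (ρ^(-1/2) ρ_x)²`. -/
noncomputable def collision (P : Protocol n A B C) (x : Str n) : ℝ :=
  (invSqrt P.meanState * P.commitState x * (invSqrt P.meanState * P.commitState x)).trace.re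

theorem posSemidef_commitState (P : Protocol n A B C) (x : Str n) :
    (P.commitState x).PosSemidef := posSemidef_bobState _

theorem overlap_afterCommit_self (P : Protocol n A B C) {A' : Type u} [Fintype A'] [DecidableEq A']
    {α : A' → ℂ} (hα : IsPure α) (U : ℕ → Matrix.unitaryGroup (A' × C) ℂ) :
    overlap (P.afterCommit α U) (P.afterCommit α U) = 1 := by
  rw [afterCommit, overlap_evolve, overlap_productVec_self hα P.bobInit_pure P.channelInit_pure]

theorem trace_commitState (P : Protocol n A B C) (x : Str n) : (P.commitState x).trace = 1 := by
  rw [commitState, trace_bobState, overlap_afterCommit_self P (P.aliceInit_pure x)]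

theorem two_pow_inv_pos (n : ℕ) : 0 < ((2 : ℝ) ^ n)⁻¹ := by positivity

theorem posSemidef_meanState (P : Protocol n A B C) : P.meanState.PosSemidef :=
  posSemidef_averageState (fun _ => (two_pow_inv_pos n).le) P.posSemidef_commitState

theorem support_mul_commitState (P : Protocol n A B C) (x : Str n) :
    cfc Real.sqrt P.meanState * invSqrt P.meanState * P.commitState x = P.commitState x :=
  support_mul_of_averageState (fun _ => two_pow_inv_pos n) P.posSemidef_commitState
    P.posSemidef_meanState.isSqrtPair x

/-- `Tr (√ρ_x √ρ)`. -/
noncomputable def affinity (P : Protocol n A B C) (x : Str n) : ℝ :=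
  (cfc Real.sqrt (P.commitState x) * cfc Real.sqrt P.meanState).trace.re

theorem one_le_affinity_sq_mul_collision (P : Protocol n A B C) (x : Str n) :
    1 ≤ P.affinity x ^ 2 * P.collision x :=
  one_le_overlap_sq_mul_collision P.posSemidef_meanState.isSqrtPair
    (P.posSemidef_commitState x).isSqrtPair (P.support_mul_commitState x)
    (by rw [trace_commitState]; rfl)

theorem affinity_nonneg (P : Protocol n A B C) (x : Str n) : 0 ≤ P.affinity x :=
  (P.posSemidef_commitState x).isSqrtPair.posSemidef.re_trace_mul_nonneg
    P.posSemidef_meanState.isSqrtPair.posSemidef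

theorem collision_pos (P : Protocol n A B C) (x : Str n) : 0 < P.collision x := by
  by_contra! h
  nlinarith [P.one_le_affinity_sq_mul_collision x, sq_nonneg (P.affinity x)]

/-- The squared weights contribute `4^(-n)` and the `n` in `xi` a factor `2^n`. Positivity of the
collision quantities is needed to cancel the logarithm. -/
theorem xi_eq (P : Protocol n A B C) :
    (2 : ℝ) ^ xi (fun _ => ((2 : ℝ) ^ n)⁻¹) P.commitState =
      ((2 : ℝ) ^ n)⁻¹ * ∑ x, P.collision x := by
  have hpos : 0 < ∑ x, P.collision x :=
    Finset.sum_pos (fun x _ => P.collision_pos x) Finset.univ_nonempty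
  rw [xi, collisionEntropy, trace_collision, ← Finset.mul_sum, sub_neg_eq_add,
    Real.rpow_add two_pos, Real.rpow_natCast, Real.rpow_logb two_pos (by norm_num)]
  · change _ * (_ * ∑ x, P.collision x) = _
    have : ((2 : ℝ) ^ n) ≠ 0 := by positivity
    field_simp
  · exact mul_pos (pow_pos (two_pow_inv_pos n) 2) hpos

/-- The pretty good measurement for the ensemble of Bob's states after the commit phase. -/
noncomputable def prettyGood (P : Protocol n A B C) : Measurement (Str n) B where
  -- The first terms only sum to the support projection of the mean state. The complementary
  -- projection, shared equally among the outcomes, completes them to the identity and annihilates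
  -- every `ρ_x`.
  op x := (((2 : ℝ) ^ n)⁻¹ : ℂ) • (invSqrt P.meanState * P.commitState x * invSqrt P.meanState
    + (1 - cfc Real.sqrt P.meanState * invSqrt P.meanState))
  posSemidef x := by
    have h := P.posSemidef_meanState.isSqrtPair
    refine PosSemidef.smul (PosSemidef.add ?_ (posSemidef_one_sub_of_isHermitian_idem
      h.proj_isHermitian h.proj_idem)) (by exact_mod_cast (two_pow_inv_pos n).le)
    have := (P.posSemidef_commitState x).mul_mul_conjTranspose_same (invSqrt P.meanState)
    rwa [h.posSemidef_inv.isHermitian.eq] at this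
  sum_eq_one := by
    have h := P.posSemidef_meanState.isSqrtPair
    have e : ∀ r : Matrix B B ℂ, ∑ x, (((2 : ℝ) ^ n)⁻¹ : ℂ) • (r * P.commitState x * r) =
        r * P.meanState * r := by
      intro r
      rw [meanState, averageState, Matrix.mul_sum, Matrix.sum_mul]
      simp
    have h2 : (2 : ℂ) ^ n ≠ 0 := by positivity
    simp only [smul_add, Finset.sum_add_distrib]
    rw [e, h.inv_mul_mul_inv, Finset.sum_const, Finset.card_univ, Fintype.card_fun,
      Fintype.card_bool, Fintype.card_fin, ← Nat.cast_smul_eq_nsmul ℂ, smul_smul]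
    push_cast
    rw [mul_inv_cancel₀ h2, one_smul, add_sub_cancel]

theorem prob_prettyGood (P : Protocol n A B C) (x : Str n) :
    P.prettyGood.prob (P.commitState x) x = ((2 : ℝ) ^ n)⁻¹ * P.collision x := by
  have e : (P.prettyGood.op x) * P.commitState x = ((((2 : ℝ) ^ n)⁻¹ : ℝ) : ℂ) •
      (invSqrt P.meanState * P.commitState x * (invSqrt P.meanState * P.commitState x)) := by
    simp only [prettyGood, Matrix.smul_mul, Matrix.add_mul, Matrix.sub_mul,
      P.support_mul_commitState x, Matrix.one_mul, sub_self, add_zero, Matrix.mul_assoc]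
    push_cast; rfl
  rw [Measurement.prob, e, trace_smul, smul_eq_mul, Complex.re_ofReal_mul]
  rfl

/-- An `(n, a, b)`-QBSC is an `(n, a, b)`-QBSC_ξ. -/
theorem IsQBSC.isQBSCXi {P : Protocol n A B C} {a b : ℝ} (h : P.IsQBSC a b) : P.IsQBSCXi a b := by
  refine ⟨h.correct, ?_, h.binding⟩
  have h1 := h.concealing P.prettyGood
  simp_rw [prob_prettyGood] at h1
  rw [← Finset.mul_sum, ← xi_eq] at h1
  exact (Real.rpow_le_rpow_left_iff one_lt_two).1 h1

/-! ### Breaking the binding condition -/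

/-- The uniform superposition of Alice's initial states. -/
noncomputable def uniformInit (P : Protocol n A B C) : Str n × A → ℂ :=
  fun i => ((Real.sqrt ((2 : ℝ) ^ n)⁻¹ : ℝ) : ℂ) * P.aliceInit i.1 i.2

theorem isPure_uniformInit (P : Protocol n A B C) : IsPure P.uniformInit := by
  have e : ∀ x, ∑ a, ‖P.aliceInit x a‖ ^ 2 = 1 := P.aliceInit_pure
  simp only [IsPure, uniformInit, Fintype.sum_prod_type, norm_mul, mul_pow, ← Finset.mul_sum, e,
    Complex.norm_real, Real.norm_eq_abs, sq_abs, Real.sq_sqrt (two_pow_inv_pos n).le]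
  simp

theorem afterCommit_uniformInit (P : Protocol n A B C) :
    P.afterCommit P.uniformInit (fun k => liftUnitary (Str n) (P.aliceCommit k)) =
      bundle fun x => ((Real.sqrt ((2 : ℝ) ^ n)⁻¹ : ℝ) : ℂ) •
        P.afterCommit (P.aliceInit x) P.aliceCommit := by
  have e : productVec P.uniformInit P.bobInit P.channelInit =
      bundle fun x => ((Real.sqrt ((2 : ℝ) ^ n)⁻¹ : ℝ) : ℂ) •
        productVec (P.aliceInit x) P.bobInit P.channelInit := by
    ext i
    simp [productVec, uniformInit, bundle, mul_assoc]
  simp only [afterCommit, e, evolve_bundle, evolve_smul]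

theorem bobState_afterCommit_uniformInit (P : Protocol n A B C) :
    bobState (P.afterCommit P.uniformInit (fun k => liftUnitary (Str n) (P.aliceCommit k))) =
      P.meanState := by
  rw [afterCommit_uniformInit, bobState_bundle, meanState, averageState]
  refine Finset.sum_congr rfl fun x _ => ?_
  rw [bobState_smul, Complex.star_def, Complex.conj_ofReal, ← Complex.ofReal_mul,
    Real.mul_self_sqrt (two_pow_inv_pos n).le]
  rfl

/-- If there is a reveal phase, the superposed commitment can be opened as `x` with probability at
least the squared affinity. -/
theorem exists_reveal (P : Protocol n A B C) (hc : P.IsCorrect) (hr : P.revealRounds ≠ 0)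
    (x : Str n) : ∃ W : ℕ → Matrix.unitaryGroup ((Str n × A) × C) ℂ,
      P.affinity x ^ 2 ≤
        P.revealProb P.uniformInit (fun k => liftUnitary (Str n) (P.aliceCommit k)) W x := by
  classical
  obtain ⟨k, hk⟩ := Nat.exists_eq_succ_of_ne_zero hr
  set Ψ := P.afterCommit P.uniformInit (fun k => liftUnitary (Str n) (P.aliceCommit k)) with hΨ
  set ψ := P.afterCommit (P.aliceInit x) P.aliceCommit with hψ
  -- The target is the honest commitment to `x` with the extra register in state `x`; it lives in
  -- the same space as `Ψ`.
  set Φ : (Str n × A) × B × C → ℂ := bundle (Pi.single x ψ) with hΦ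
  have hbundle : ∀ χ : A × B × C → ℂ, bobState (bundle (Pi.single x χ)) = bobState χ := by
    intro χ
    rw [bobState_bundle, Finset.sum_eq_single x]
    · rw [Pi.single_eq_same]
    · intro y _ hy
      rw [Pi.single_eq_of_ne hy]
      ext; simp [bobState]
    · simp
  obtain ⟨U, hU, hov⟩ := exists_unitary_overlap P.posSemidef_meanState.isSqrtPair
    (P.posSemidef_commitState x).isSqrtPair (X := bobMatrix Ψ) (Y := bobMatrix Φ)
    (by rw [← bobState_eq, hΨ, bobState_afterCommit_uniformInit])
    (by rw [← bobState_eq, hbundle]; rfl)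
  -- Alice's action is right multiplication by the transpose on `bobMatrix`, hence the transpose
  -- here.
  let U' : Matrix.unitaryGroup ((Str n × A) × C) ℂ := ⟨Uᵀ, transpose_mem_unitaryGroup_iff.2 hU⟩
  let R : ℕ → Matrix.unitaryGroup ((Str n × A) × C) ℂ :=
    fun i => liftUnitary (Str n) (P.aliceReveal i)
  have hfin : evolve R P.bobReveal Φ P.revealRounds =
      bundle (Pi.single x (evolve P.aliceReveal P.bobReveal ψ P.revealRounds)) := by
    rw [hΦ, evolve_bundle]
    congr 1
    ext1 y
    by_cases hy : y = x
    · subst hy; simp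
    · rw [Pi.single_eq_of_ne hy, Pi.single_eq_of_ne hy, evolve_zero_vec]
  refine ⟨fun i => if i = 0 then R 0 * U' else R i, ?_⟩
  have hprob : P.test.prob (bobState (evolve R P.bobReveal Φ P.revealRounds)) (some x) = 1 := by
    rw [hfin, hbundle]
    exact hc x
  have hnorm : overlap (evolve R P.bobReveal Φ P.revealRounds)
      (evolve R P.bobReveal Φ P.revealRounds) = 1 := by
    rw [← trace_bobState, hfin, hbundle, trace_bobState, overlap_evolve, hψ,
      overlap_afterCommit_self P (P.aliceInit_pure x)]
  have h := P.test.sq_overlap_le_prob (ψ := evolve R P.bobReveal (aliceAct U' Ψ) P.revealRounds)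
    hnorm hprob
  rw [overlap_evolve] at h
  have hrev : evolve (fun i => if i = 0 then R 0 * U' else R i) P.bobReveal Ψ P.revealRounds =
      evolve R P.bobReveal (aliceAct U' Ψ) P.revealRounds := by
    rw [hk]; exact evolve_merge _ _ _ _ _
  rw [revealProb, hrev]
  refine le_trans ?_ h
  have e : overlap Φ (aliceAct U' Ψ) = ((bobMatrix Φ)ᴴ * (bobMatrix Ψ * U)).trace := by
    rw [overlap, bobMatrix_aliceAct]
    rfl
  rw [e]
  exact pow_le_pow_left₀ (P.affinity_nonneg x) hov 2

/-- Without a reveal phase Bob's states after the commit phase are perfectly distinguishable. -/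
theorem collision_eq_of_revealRounds_eq_zero (P : Protocol n A B C) (hc : P.IsCorrect)
    (hr : P.revealRounds = 0) (x : Str n) : P.collision x = 2 ^ n := by
  set p : ℝ := ((2 : ℝ) ^ n)⁻¹ with hp
  set E : Str n → Matrix B B ℂ := fun x => P.test.op (some x) with hE
  have h1 : ∀ y, (E y * P.commitState y).trace.re = 1 := by
    intro y
    have := hc y
    rwa [revealProb, hr] at this
  have hfix : ∀ y, E y * P.commitState y = P.commitState y := by
    intro y
    have := (P.test.posSemidef_one_sub (some y)).mul_eq_zero_of_re_trace
      (P.posSemidef_commitState y) (by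
        rw [Matrix.sub_mul, Matrix.one_mul, trace_sub, trace_commitState, Complex.sub_re]
        change _ - (E y * P.commitState y).trace.re = 0
        rw [h1]; simp)
    rw [Matrix.sub_mul, Matrix.one_mul, sub_eq_zero] at this
    exact this.symm
  have hzero : ∀ y, y ≠ x → E x * P.commitState y = 0 := by
    intro y hy
    apply (P.test.posSemidef (some x)).mul_eq_zero_of_re_trace (P.posSemidef_commitState y)
    have h3 : ((1 - P.test.op (some y)) * P.commitState y) = 0 := by
      rw [Matrix.sub_mul, Matrix.one_mul, sub_eq_zero]; exact (hfix y).symm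
    have h4 : 1 - P.test.op (some y) =
        ∑ z ∈ Finset.univ.erase (some y), P.test.op z := by
      rw [← P.test.sum_eq_one, ← Finset.add_sum_erase _ _ (Finset.mem_univ (some y)),
        add_sub_cancel_left]
    have h5 : ∑ z ∈ Finset.univ.erase (some y), (P.test.op z * P.commitState y).trace.re = 0 := by
      rw [← Complex.re_sum, ← trace_sum, ← Matrix.sum_mul, ← h4, h3]; simp
    exact (Finset.sum_eq_zero_iff_of_nonneg fun z _ =>
      (P.test.posSemidef z).re_trace_mul_nonneg (P.posSemidef_commitState y)).1 h5 _
        (by simpa using Ne.symm hy)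
  -- `E x` fixes `ρ_x` and kills the other states. The product is Hermitian, so `E x` commutes with
  -- the mean state and hence with its inverse square root.
  have hEm : E x * P.meanState = (p : ℂ) • P.commitState x := by
    rw [meanState, averageState, Matrix.mul_sum, Finset.sum_eq_single x]
    · rw [Matrix.mul_smul, hfix]
    · intro y _ hy
      rw [Matrix.mul_smul, hzero y hy, smul_zero]
    · simp
  have hcomm : Commute P.meanState (E x) := by
    have h := congrArg conjTranspose hEm
    rw [conjTranspose_mul, conjTranspose_smul, (P.posSemidef_commitState x).isHermitian.eq,
      P.posSemidef_meanState.isHermitian.eq, (P.test.posSemidef (some x)).isHermitian.eq,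
      Complex.star_def, Complex.conj_ofReal, ← hEm] at h
    exact h
  have hcr : E x * invSqrt P.meanState = invSqrt P.meanState * E x :=
    (hcomm.cfc_real fun t => (Real.sqrt t)⁻¹).symm.eq
  set r := invSqrt P.meanState with hrdef
  have h := P.posSemidef_meanState.isSqrtPair
  have key : (p : ℂ) • (r * P.commitState x * (r * P.commitState x)) = E x * P.commitState x := by
    calc (p : ℂ) • (r * P.commitState x * (r * P.commitState x))
        = r * ((p : ℂ) • P.commitState x) * r * P.commitState x := by
          simp only [Matrix.mul_smul, Matrix.smul_mul, Matrix.mul_assoc]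
      _ = E x * (r * P.meanState * r * P.commitState x) := by
          rw [← hEm, ← Matrix.mul_assoc r, ← hcr]; simp only [Matrix.mul_assoc]
      _ = E x * P.commitState x := by
          rw [h.inv_mul_mul_inv, P.support_mul_commitState]
  have h6 := congrArg (fun M => (trace M).re) key
  simp only [trace_smul, smul_eq_mul, Complex.re_ofReal_mul, h1] at h6
  have h7 : p * P.collision x = 1 := h6
  rw [hp] at h7
  field_simp at h7
  exact h7

/-- The binding and concealing parameters of a correct protocol satisfy `n ≤ a + b`. -/
theorem IsQBSCXi.le_add {P : Protocol n A B C} {a b : ℝ} (h : P.IsQBSCXi a b) : n ≤ a + b := by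
  have hS : ((2 : ℝ) ^ n)⁻¹ * ∑ x, P.collision x ≤ 2 ^ b := by
    rw [← xi_eq]
    exact (Real.rpow_le_rpow_left_iff one_lt_two).2 h.concealing
  have hcard : ((Finset.univ : Finset (Str n)).card : ℝ) = 2 ^ n := by
    simp [Finset.card_univ]
  have h2n : (0 : ℝ) < 2 ^ n := by positivity
  suffices hab : (2 : ℝ) ^ n ≤ 2 ^ a * 2 ^ b by
    rw [← Real.rpow_add two_pos, ← Real.rpow_natCast] at hab
    exact (Real.rpow_le_rpow_left_iff one_lt_two).1 hab
  by_cases hr : P.revealRounds = 0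
  · have hb : (2 : ℝ) ^ n ≤ 2 ^ b := by
      simp_rw [P.collision_eq_of_revealRounds_eq_zero h.correct hr] at hS
      rwa [Finset.sum_const, nsmul_eq_mul, hcard, ← mul_assoc, inv_mul_cancel₀ h2n.ne',
        one_mul] at hS
    have ha : (1 : ℝ) ≤ 2 ^ a := by
      -- Any string would do: honest play for one fixed string already contributes `1` to the
      -- binding sum.
      let x : Str n := fun _ => false
      refine le_trans ?_ (h.binding A (P.aliceInit x) (P.aliceInit_pure x) P.aliceCommit
        fun _ => P.aliceReveal)
      rw [← h.correct x]
      exact Finset.single_le_sum (f := fun y => P.revealProb (P.aliceInit x) P.aliceCommit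
        P.aliceReveal y) (fun y _ => P.test.prob_nonneg (posSemidef_bobState _) _)
        (Finset.mem_univ x)
    nlinarith
  · choose W hW using P.exists_reveal h.correct hr
    have hbind := h.binding (Str n × A) P.uniformInit P.isPure_uniformInit
      (fun k => liftUnitary (Str n) (P.aliceCommit k)) W
    have hpos : 0 < ∑ x, P.collision x :=
      Finset.sum_pos (fun x _ => P.collision_pos x) Finset.univ_nonempty
    have h1 : ((2 : ℝ) ^ n) ^ 2 / ∑ x, P.collision x ≤ 2 ^ a := by
      -- Cauchy–Schwarz in the form `(∑ 1)² / ∑ t_x ≤ ∑ 1 / t_x`, whose terms are bounded by the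
      -- opening probabilities.
      have h3 := Finset.univ.sq_sum_div_le_sum_sq_div (fun _ => (1 : ℝ))
        fun x _ => P.collision_pos x
      rw [Finset.sum_const, nsmul_eq_mul, mul_one, hcard] at h3
      refine h3.trans ((Finset.sum_le_sum fun x _ => ?_).trans hbind)
      refine le_trans ?_ (hW x)
      rw [one_pow, div_le_iff₀ (P.collision_pos x)]
      exact P.one_le_affinity_sq_mul_collision x
    calc (2 : ℝ) ^ n = ((2 : ℝ) ^ n) ^ 2 / (∑ x, P.collision x) *
          (((2 : ℝ) ^ n)⁻¹ * ∑ x, P.collision x) := by field_simp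
      _ ≤ 2 ^ a * 2 ^ b := by gcongr

end Protocol

/-- It rests on `2^65 < 5^28` and `5^31 < 2^72`. Under `t ↦ 5 t - 4` the two bounds become exactly
`7.61 ± 0.005`. -/
theorem logb_two_five_bounds : 2.321 < Real.logb 2 5 ∧ Real.logb 2 5 < 2.323 := by
  have h1 : (65 : ℝ) < 28 * Real.logb 2 5 := by
    have : (28 : ℝ) * Real.logb 2 5 = Real.logb 2 (5 ^ 28) := by
      rw [Real.logb_pow]; norm_num
    rw [this, Real.lt_logb_iff_rpow_lt one_lt_two (by positivity)]
    norm_num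
  have h2 : 31 * Real.logb 2 5 < (72 : ℝ) := by
    have : (31 : ℝ) * Real.logb 2 5 = Real.logb 2 (5 ^ 31) := by
      rw [Real.logb_pow]; norm_num
    rw [this, Real.logb_lt_iff_lt_rpow one_lt_two (by positivity)]
    norm_num
  constructor <;> linarith

end QBSC

theorem mainTheorem1 (n : ℕ) (a b : ℝ) (A B C : Type*)
    [Fintype A] [DecidableEq A] [Fintype B] [DecidableEq B] [Fintype C] [DecidableEq C]
    (P : QBSC.Protocol n A B C) :
    (P.IsQBSC a b → P.IsQBSCXi a b) ∧
    (a + b + (5 * Real.logb 2 5 - 4) < n → ¬ P.IsQBSCXi a b ∧ ¬ P.IsQBSC a b) ∧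
    |(5 * Real.logb 2 5 - 4) - 7.61| < 0.005 := by
  obtain ⟨h1, h2⟩ := QBSC.logb_two_five_bounds
  refine ⟨fun h => h.isQBSCXi, fun hn => ?_, ?_⟩
  -- Only the positivity of `c`, from the lower bound `h1`, is used against `n ≤ a + b`.
  · have hxi : ¬ P.IsQBSCXi a b := fun h => by linarith [h.le_add]
    exact ⟨hxi, fun h => hxi h.isQBSCXi⟩
  · rw [abs_lt]
    constructor <;> linarith
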